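/- Let $d$ be a natural number and let $\mathcal K(\mathbb R^d)$ be the metric space of nonempty compact subsets of $\mathbb R^d$ with the Hausdorff metric. In a metric space $X$, the upper box dimension of a bounded set $A$ is $$\overline{\dim}_B A=\inf\{s\ge 0:\ \limsup_{\varepsilon\to0+}N(A,\varepsilon)\,\varepsilon^{s}=0\},$$ where $N(A,\varepsilon)$ is the least number of $\varepsilon$-balls of $X$ needed to cover $A$ (with $\overline{\dim}_B A=\infty$ if there is no such $s$), and the packing dimension of a set $A\subset X$ is $$\dim_P A=\inf\Big\{\sup_i\overline{\dim}_B A_i:\ A_1,A_2,\dots\text{ bounded},\ A\subset\bigcup_{i=1}^\infty A_i\Big\}.$$ An element of a family $\mathcal A$ of Lebesgue measurable subsets of $\mathbb R^d$ of finite measure \emph{can be reconstructed using $n$ test sets} if there are Lebesgue measurable sets $T_1,\dots,T_n\subset\mathbb R^d$ such that whenever $A,B\in\mathcal A$ and $\lambda^d(A\cap T_i)=\lambda^d(B\cap T_i)$ for every $i=1,\dots,n$, then $A=B$. Let $\mathcal C\subset\mathcal K(\mathbb R^d)$ be such that $K=\overline{\operatorname{int}K}$ for every $K\in\mathcal C$.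 1. If $k\ge1$ is an integer, $\dim_P\mathcal C\le k$, and $\overline{\dim}_B\,\partial K=d-1$ for every $K\in\mathcal C$, then an element of $\mathcal C$ can be reconstructed using $2k+1$ test sets. 2. If $b<d$ is a real number, $\dim_P\mathcal C<\infty$, and $\overline{\dim}_B\,\partial K\le b$ for every $K\in\mathcal C$, then an element of $\mathcal C$ can be reconstructed using $\left\lfloor\frac{2\dim_P\mathcal C}{d-b}\right\rfloor+1$ test sets. -/

import Mathlib

open MeasureTheory Metric Set Filter Topology TopologicalSpace
open scoped NNReal ENNReal

/-- An element of the family `𝒜` of subsets of `ℝ^d` can be reconstructed using `n` test sets: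
there are Lebesgue measurable sets `T₁, …, Tₙ` such that the measures `λ(A ∩ Tᵢ)` determine
the member `A` of `𝒜`. -/
def CanBeReconstructed {d : ℕ} (𝒜 : Set (Set (EuclideanSpace ℝ (Fin d)))) (n : ℕ) : Prop :=
  ∃ T : Fin n → Set (EuclideanSpace ℝ (Fin d)),
    (∀ i, NullMeasurableSet (T i) volume) ∧
    ∀ A ∈ 𝒜, ∀ B ∈ 𝒜, (∀ i, volume (A ∩ T i) = volume (B ∩ T i)) → A = B

/-- Upper box dimension: the infimum of all `s` such that `N(A, ε) ε^s` has upper limit `0`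
as `ε → 0+`. Here `N(A, ε)` is the least number of `ε`-balls of the ambient space covering `A`
(`Metric.externalCoveringNumber` takes closed balls, which gives the same dimension as open
balls). The exponents are restricted to `s ≥ 0`; this only affects the empty set, which gets
dimension `0`. -/
noncomputable def upperBoxDim {X : Type*} [PseudoMetricSpace X] (A : Set X) : ℝ≥0∞ :=
  ⨅ (s : ℝ≥0) (_ : limsup (fun ε : ℝ≥0 ↦
      (externalCoveringNumber ε A : ℝ≥0∞) * (ε : ℝ≥0∞) ^ (s : ℝ)) (𝓝[>] 0) = 0), (s : ℝ≥0∞)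

/-- Packing dimension (modified upper box dimension): the infimum of `supᵢ` of the upper box
dimensions of the pieces, over all countable covers by bounded sets. -/
noncomputable def packingDim {X : Type*} [PseudoMetricSpace X] (A : Set X) : ℝ≥0∞ :=
  ⨅ (S : ℕ → Set X) (_ : (∀ i, Bornology.IsBounded (S i)) ∧ A ⊆ ⋃ i, S i),
    ⨆ i, upperBoxDim (S i)

/-- The family of subsets of `ℝ^d` underlying a subset of the space of nonempty compact sets
(which in Mathlib carries the Hausdorff metric). -/
def underlyingSets {d : ℕ} (C : Set (NonemptyCompacts (EuclideanSpace ℝ (Fin d)))) :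
    Set (Set (EuclideanSpace ℝ (Fin d))) :=
  (fun K : NonemptyCompacts (EuclideanSpace ℝ (Fin d)) ↦ (K : Set (EuclideanSpace ℝ (Fin d)))) '' C

/-! The test sets are chosen at random. Fix disjoint bounded sets `D j` of positive measure such
that every nonempty open set contains one, and inside each a monotone family `S j u` of measure `u *
μ (D j)`. A random test set is `⋃ j, S j (ω j)` with independent uniform `ω j`.

If `A ≠ B` are closures of their interiors, some `D j` lies in `A \ B` or `B \ A`. With the other
coordinates frozen, the difference of the measures of `A ∩ T` and `B ∩ T` is affine in `ω j` with
slope `± μ (D j)`, so it is at most `η` in absolute value with probability `O(η)`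
(`infinitePi_abs_measureReal_sub_le`). Moving `A` by `ε` in the Hausdorff metric changes the measure
of `A ∩ T` by `O(ε ^ (d - b))`, because the symmetric difference lies near the two frontiers. A
union bound over `ε ^ (-2s)` pairs of balls and `n` independent test sets bounds the failure
probability by a multiple of `ε ^ (n (d - b) - 2s)`, which tends to `0` when `n (d - b) > 2s`
(`pi_exists_measure_inter_eq_zero`). Countably many null events then cover all pairs. -/

/-! ### Building blocks of the random test set -/

section Haar

variable {E : Type*} [NormedAddCommGroup E] [NormedSpace ℝ E] [FiniteDimensional ℝ E]
  [Nontrivial E] [MeasurableSpace E] [BorelSpace E] (μ : Measure E) [μ.IsAddHaarMeasure]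

/-- Inside a bounded measurable set `D` there is a monotone family of measurable subsets
`S u`, `u ∈ [0, 1]`, such that `S u` has measure `u * μ D`. -/
theorem exists_monotone_subsets_measureReal_eq {D : Set E} (hD : MeasurableSet D)
    (hb : Bornology.IsBounded D) :
    ∃ S : unitInterval → Set E, Monotone S ∧ (∀ u, MeasurableSet (S u)) ∧ (∀ u, S u ⊆ D) ∧
      ∀ u, μ.real (S u) = u * μ.real D := by
  have hfin : μ D ≠ ⊤ := hb.measure_lt_top.ne
  obtain ⟨R, hR0, hR⟩ : ∃ R : ℝ, 0 ≤ R ∧ D ⊆ closedBall 0 R := by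
    obtain ⟨R, hR⟩ := hb.subset_closedBall (0 : E)
    exact ⟨max R 0, le_max_right _ _, hR.trans (closedBall_subset_closedBall (le_max_left _ _))⟩
  rcases eq_or_ne (μ.real D) 0 with h0 | hpos
  · exact ⟨fun _ ↦ D, monotone_const, fun _ ↦ hD, fun _ ↦ subset_rfl, fun u ↦ by simp [h0]⟩
  -- `D` is swept out by growing balls; `F` is continuous because its increments are at most the
  -- volumes of the shells.
  set F : ℝ → ℝ := fun t ↦ μ.real (D ∩ closedBall 0 t) with hF
  have hFfin : ∀ t, μ (D ∩ closedBall 0 t) ≠ ⊤ := fun t ↦ measure_inter_ne_top_of_left_ne_top hfin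
  have hmono : Monotone F := fun s t hst ↦ measureReal_mono
    (inter_subset_inter_right _ (closedBall_subset_closedBall hst)) (hFfin t)
  have hcont : ContinuousOn F (Icc 0 R) := by
    set G : ℝ → ℝ := fun t ↦ t ^ Module.finrank ℝ E * μ.real (ball 0 1) with hG
    have key : ∀ s ∈ Icc 0 R, ∀ t ∈ Icc 0 R, dist (F s) (F t) ≤ dist (G s) (G t) := by
      have aux : ∀ s ∈ Icc 0 R, ∀ t ∈ Icc 0 R, s ≤ t → dist (F s) (F t) ≤ dist (G s) (G t) := by
        intro s hs t ht hst
        have h1 : F t - F s ≤ G t - G s := by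
          have e1 : F t ≤ F s + μ.real (closedBall 0 t \ closedBall 0 s) := by
            refine (measureReal_mono ?_ ?_).trans (measureReal_union_le _ _)
            · rintro x ⟨hx, hxt⟩
              by_cases hxs : x ∈ closedBall (0 : E) s
              · exact Or.inl ⟨hx, hxs⟩
              · exact Or.inr ⟨hxt, hxs⟩
            · exact measure_union_ne_top (hFfin s)
                (measure_ne_top_of_subset sdiff_subset measure_closedBall_lt_top.ne)
          rw [measureReal_sdiff (closedBall_subset_closedBall hst)
            measurableSet_closedBall measure_closedBall_lt_top.ne,
            Measure.addHaar_real_closedBall μ _ hs.1, Measure.addHaar_real_closedBall μ _ ht.1] at e1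
          simp only [hG]; linarith
        have h2 := hmono hst
        rw [dist_comm, dist_comm (G s), Real.dist_eq, Real.dist_eq, abs_of_nonneg (by linarith)]
        exact h1.trans (le_abs_self _)
      intro s hs t ht
      rcases le_total s t with h | h
      · exact aux s hs t ht h
      · rw [dist_comm, dist_comm (G s)]; exact aux t ht s hs h
    have hGc : Continuous G := by fun_prop
    intro s hs
    rw [ContinuousWithinAt, tendsto_iff_dist_tendsto_zero]
    refine squeeze_zero' (Eventually.of_forall fun _ ↦ dist_nonneg)
      (eventually_mem_nhdsWithin.mono fun t ht ↦ key t ht s hs) ?_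
    exact tendsto_iff_dist_tendsto_zero.1 hGc.continuousWithinAt
  have hF0 : F 0 = 0 := by
    have : μ (D ∩ closedBall 0 0) = 0 :=
      measure_mono_null inter_subset_right (by simp)
    simp only [hF, measureReal_def, this, ENNReal.toReal_zero]
  have hFR : F R = μ.real D := by simp only [hF, inter_eq_left.2 hR]
  have hpos' : 0 < μ.real D := lt_of_le_of_ne measureReal_nonneg hpos.symm
  have hex : ∀ u : unitInterval, ∃ t, F t = u * μ.real D := by
    intro u
    obtain ⟨t, -, ht⟩ := intermediate_value_Icc hR0 hcont
      (show (u : ℝ) * μ.real D ∈ Icc (F 0) (F R) by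
        rw [hF0, hFR]
        exact ⟨mul_nonneg u.2.1 hpos'.le, mul_le_of_le_one_left hpos'.le u.2.2⟩)
    exact ⟨t, ht⟩
  choose τ hτ using hex
  refine ⟨fun u ↦ D ∩ closedBall 0 (τ u), ?_, fun u ↦ hD.inter measurableSet_closedBall,
    fun u ↦ inter_subset_left, hτ⟩
  intro u v huv
  rcases huv.eq_or_lt with rfl | hlt
  · exact le_rfl
  · refine inter_subset_inter_right _ (closedBall_subset_closedBall ?_)
    by_contra! h
    have := hmono h.le
    rw [hτ, hτ] at this
    exact absurd (le_of_mul_le_mul_right this hpos') (not_le.2 hlt)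

/-- There is a disjoint sequence of measurable sets of positive measure such that every nonempty
open set contains one of them. -/
theorem exists_disjoint_seq_subset_of_isOpen :
    ∃ D : ℕ → Set E, Pairwise (Function.onFun Disjoint D) ∧ (∀ j, MeasurableSet (D j)) ∧
      (∀ j, Bornology.IsBounded (D j)) ∧ (∀ j, 0 < μ.real (D j)) ∧
      ∀ U : Set E, IsOpen U → U.Nonempty → ∃ j, D j ⊆ U := by
  -- Unpairing makes each dense point a centre infinitely often, hence with arbitrarily small radii.
  set x : ℕ → E := fun j ↦ denseSeq E j.unpair.1
  set r : ℕ → ℝ := fun j ↦ (1 / 4) ^ j with hr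
  have hr0 : ∀ j, 0 < r j := fun j ↦ by positivity
  set B : ℕ → Set E := fun j ↦ ball (x j) (r j)
  set D : ℕ → Set E := fun j ↦ B j \ ⋃ i, B (j + 1 + i) with hDdef
  have hsub : ∀ j, D j ⊆ B j := fun j ↦ sdiff_subset
  have hmeas : ∀ j, MeasurableSet (D j) := fun j ↦
    measurableSet_ball.diff (MeasurableSet.iUnion fun i ↦ measurableSet_ball)
  have hdisj : ∀ i j, i < j → Disjoint (D i) (D j) := by
    intro i j hij
    rw [Set.disjoint_left]
    intro y hy hy'
    refine hy.2 (mem_iUnion.2 ⟨j - (i + 1), ?_⟩)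
    have : i + 1 + (j - (i + 1)) = j := by omega
    rw [this]
    exact hsub j hy'
  set q : ℝ := (1 / 4) ^ Module.finrank ℝ E with hq
  have hq1 : q ≤ 1 / 4 := by
    simpa only [pow_one] using pow_le_pow_of_le_one (by norm_num : (0 : ℝ) ≤ 1 / 4) (by norm_num)
      (Module.finrank_pos (R := ℝ) (M := E) : 1 ≤ _)
  have hq0 : 0 < q := by positivity
  have hω0 : μ (ball (0 : E) 1) ≠ 0 := (measure_ball_pos μ 0 one_pos).ne'
  have hω1 : μ (ball (0 : E) 1) ≠ ⊤ := measure_ball_lt_top.ne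
  have hB : ∀ j, μ (B j) = ENNReal.ofReal (q ^ j) * μ (ball 0 1) := by
    intro j
    rw [Measure.addHaar_ball μ _ (hr0 j).le, hq, hr, ← pow_mul, ← pow_mul, mul_comm j]
  have hpos : ∀ j, 0 < μ.real (D j) := by
    intro j
    -- If `D j` were null, the later balls would fill `B j`, forcing `1 ≤ q / (1 - q)`; but `q ≤ 1 /
    -- 4`.
    refine ENNReal.toReal_pos (fun h0 ↦ ?_)
      (measure_ne_top_of_subset (hsub j) measure_ball_lt_top.ne)
    have hs : HasSum (fun i ↦ q ^ (j + 1 + i)) (q ^ (j + 1) * (1 - q)⁻¹) := by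
      simpa only [pow_add] using
        (hasSum_geometric_of_lt_one hq0.le (by linarith : q < 1)).mul_left (q ^ (j + 1))
    have h1 : μ (B j) ≤ ENNReal.ofReal (q ^ (j + 1) * (1 - q)⁻¹) * μ (ball 0 1) := by
      calc μ (B j) ≤ μ (D j ∪ ⋃ i, B (j + 1 + i)) :=
            measure_mono fun y hy ↦ by
              by_cases h : y ∈ ⋃ i, B (j + 1 + i)
              exacts [Or.inr h, Or.inl ⟨hy, h⟩]
        _ ≤ μ (D j) + μ (⋃ i, B (j + 1 + i)) := measure_union_le _ _
        _ ≤ ∑' i, μ (B (j + 1 + i)) := by rw [h0, zero_add]; exact measure_iUnion_le _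
        _ = _ := by
          simp_rw [hB]
          rw [ENNReal.tsum_mul_right, ← hs.tsum_eq,
            ENNReal.ofReal_tsum_of_nonneg (fun i ↦ by positivity) hs.summable]
    rw [hB, ENNReal.mul_le_mul_iff_left hω0 hω1, ENNReal.ofReal_le_ofReal_iff
      (mul_nonneg (by positivity) (inv_nonneg.2 (by linarith))), pow_succ, mul_assoc] at h1
    have h2 : 1 ≤ q * (1 - q)⁻¹ := le_of_mul_le_mul_left (by simpa using h1) (pow_pos hq0 j)
    rw [← div_eq_mul_inv, le_div_iff₀ (by linarith)] at h2
    linarith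
  refine ⟨D, ?_, hmeas, fun j ↦ isBounded_ball.subset (hsub j), hpos, ?_⟩
  · intro i j hij
    rcases lt_or_gt_of_ne hij with h | h
    · exact hdisj i j h
    · exact (hdisj j i h).symm
  · intro U hU hne
    obtain ⟨a, ha⟩ := (denseRange_denseSeq E).exists_mem_open hU hne
    obtain ⟨ρ, hρ, hsubU⟩ := Metric.isOpen_iff.1 hU _ ha
    obtain ⟨m, hm⟩ := exists_pow_lt_of_lt_one hρ (by norm_num : (1 / 4 : ℝ) < 1)
    refine ⟨Nat.pair a m, (hsub _).trans (Subset.trans ?_ hsubU)⟩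
    have hx : x (Nat.pair a m) = denseSeq E a := by simp [x]
    simp only [B, hx]
    refine ball_subset_ball ((pow_le_pow_of_le_one (by norm_num) (by norm_num)
      (Nat.right_le_pair a m)).trans hm.le)

end Haar

/-! ### Small ball estimate for the random test set -/

/-- Resampling one coordinate preserves an infinite product of probability measures. -/
theorem map_update_prod_infinitePi {ι X : Type*} [DecidableEq ι] [MeasurableSpace X]
    (ν : Measure X) [IsProbabilityMeasure ν] (j : ι) :
    (ν.prod (Measure.infinitePi fun _ : ι ↦ ν)).map (fun p ↦ Function.update p.2 j p.1) =
      Measure.infinitePi fun _ : ι ↦ ν := by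
  have hm : Measurable fun p : X × (ι → X) ↦ Function.update p.2 j p.1 :=
    measurable_update'.comp measurable_swap
  refine Measure.eq_infinitePi _ fun s t ht ↦ ?_
  rw [Measure.map_apply hm (MeasurableSet.pi s.countable_toSet fun i _ ↦ ht i)]
  by_cases hj : j ∈ s
  · have : (fun p : X × (ι → X) ↦ Function.update p.2 j p.1) ⁻¹' Set.pi s t =
        t j ×ˢ Set.pi (s.erase j) t := by
      ext ⟨u, w⟩
      simp only [mem_preimage, Set.mem_pi, Finset.mem_coe, mem_prod, Finset.mem_erase]
      constructor
      · intro h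
        refine ⟨by simpa using h j hj, fun i hi ↦ by simpa [hi.1] using h i hi.2⟩
      · rintro ⟨h1, h2⟩ i hi
        rcases eq_or_ne i j with rfl | h
        · simpa using h1
        · simpa [h] using h2 i ⟨h, hi⟩
    rw [this, Measure.prod_prod, Measure.infinitePi_pi _ fun i _ ↦ ht i,
      Finset.mul_prod_erase s (fun i ↦ ν (t i)) hj]
  · have : (fun p : X × (ι → X) ↦ Function.update p.2 j p.1) ⁻¹' Set.pi s t =
        univ ×ˢ Set.pi s t := by
      ext ⟨u, w⟩
      simp only [mem_preimage, Set.mem_pi, Finset.mem_coe, mem_prod, mem_univ, true_and]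
      refine forall₂_congr fun i hi ↦ ?_
      rw [Function.update_of_ne (ne_of_mem_of_not_mem hi hj)]
    rw [this, Measure.prod_prod, measure_univ, one_mul, Measure.infinitePi_pi _ fun i _ ↦ ht i]

/-- Points of `[0, 1]` at which an affine function of slope `a` is at most `ε` in absolute value. -/
theorem volume_unitInterval_abs_affine_le {a : ℝ} (ha : 0 < a) (g ε : ℝ) :
    volume {u : unitInterval | |u * a + g| ≤ ε} ≤ ENNReal.ofReal (2 / a * ε) := by
  have hsub : (Subtype.val '' {u : unitInterval | |u * a + g| ≤ ε}) ⊆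
      Icc ((-ε - g) / a) ((ε - g) / a) := by
    rintro _ ⟨u, hu, rfl⟩
    have := abs_le.1 (mem_ofPred_eq ▸ hu)
    exact ⟨by rw [div_le_iff₀ ha]; linarith, by rw [le_div_iff₀ ha]; linarith⟩
  calc volume {u : unitInterval | |u * a + g| ≤ ε}
      = volume (Subtype.val '' {u : unitInterval | |u * a + g| ≤ ε}) := by
        rw [unitInterval.volume_def, comap_subtype_coe_apply measurableSet_Icc]
    _ ≤ volume (Icc ((-ε - g) / a) ((ε - g) / a)) := measure_mono hsub
    _ = ENNReal.ofReal (2 / a * ε) := by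
        rw [Real.volume_Icc]; congr 1; ring

section RandomSet

variable {E : Type*} [MeasurableSpace E] {μ : Measure E}
  {D : ℕ → Set E} {S : ℕ → unitInterval → Set E}

theorem measurable_measure_inter_iUnion (hD : Pairwise (Function.onFun Disjoint D))
    (hS : ∀ j, Monotone (S j)) (hSm : ∀ j u, MeasurableSet (S j u)) (hSD : ∀ j u, S j u ⊆ D j)
    {A : Set E} (hA : MeasurableSet A) :
    Measurable fun ω : ℕ → unitInterval ↦ μ (A ∩ ⋃ j, S j (ω j)) := by
  have : (fun ω : ℕ → unitInterval ↦ μ (A ∩ ⋃ j, S j (ω j))) =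
      fun ω ↦ ∑' j, μ (A ∩ S j (ω j)) := by
    ext ω
    rw [inter_iUnion, measure_iUnion _ fun j ↦ hA.inter (hSm j _)]
    intro i j hij
    exact (hD hij).mono (inter_subset_right.trans (hSD i _)) (inter_subset_right.trans (hSD j _))
  rw [this]
  refine Measurable.tsum fun j ↦ ?_
  -- This is why the families `S j` were made monotone: measurability in `u` comes for free.
  have hmono : Monotone fun u ↦ μ (A ∩ S j u) := fun u v huv ↦
    measure_mono (inter_subset_inter_right _ (hS j huv))
  exact hmono.measurable.comp (measurable_pi_apply j)

/-- Small ball estimate for the difference of the measures of the intersections of two sets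
with a random set. -/
theorem infinitePi_abs_measureReal_sub_le (hD : Pairwise (Function.onFun Disjoint D))
    (hS : ∀ j, Monotone (S j)) (hSm : ∀ j u, MeasurableSet (S j u)) (hSD : ∀ j u, S j u ⊆ D j)
    {j : ℕ} (hj : 0 < μ.real (D j)) (hSμ : ∀ u, μ.real (S j u) = u * μ.real (D j))
    {A B : Set E} (hA : MeasurableSet A) (hB : MeasurableSet B) (hAμ : μ A ≠ ⊤)
    (hAB : D j ⊆ A \ B) (ε : ℝ) :
    Measure.infinitePi (fun _ : ℕ ↦ (volume : Measure unitInterval))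
      {ω | |μ.real (A ∩ ⋃ j, S j (ω j)) - μ.real (B ∩ ⋃ j, S j (ω j))| ≤ ε} ≤
      ENNReal.ofReal (2 / μ.real (D j) * ε) := by
  classical
  set P := Measure.infinitePi (fun _ : ℕ ↦ (volume : Measure unitInterval)) with hP
  set bad := {ω : ℕ → unitInterval |
    |μ.real (A ∩ ⋃ j, S j (ω j)) - μ.real (B ∩ ⋃ j, S j (ω j))| ≤ ε}
  have hbad : MeasurableSet bad := by
    refine measurableSet_le (Measurable.abs (Measurable.sub ?_ ?_)) measurable_const
    · exact (measurable_measure_inter_iUnion hD hS hSm hSD hA).ennreal_toReal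
    · exact (measurable_measure_inter_iUnion hD hS hSm hSD hB).ennreal_toReal
  have hm : Measurable fun p : unitInterval × (ℕ → unitInterval) ↦ Function.update p.2 j p.1 :=
    measurable_update'.comp measurable_swap
  -- Resample the `j`-th coordinate and apply Fubini; only the one-dimensional slice in that
  -- coordinate has to be estimated.
  rw [hP, ← map_update_prod_infinitePi volume j, Measure.map_apply hm hbad,
    Measure.prod_apply_symm (hm hbad)]
  calc ∫⁻ ω, volume ((fun u ↦ (u, ω)) ⁻¹' ((fun p : unitInterval × (ℕ → unitInterval) ↦
          Function.update p.2 j p.1) ⁻¹' bad)) ∂P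
      ≤ ∫⁻ _, ENNReal.ofReal (2 / μ.real (D j) * ε) ∂P := lintegral_mono fun ω ↦ ?_
    _ = ENNReal.ofReal (2 / μ.real (D j) * ε) := by simp
  set R : Set E := ⋃ i ∈ {i | i ≠ j}, S i (ω i) with hR
  have hRm : MeasurableSet R := MeasurableSet.biUnion (to_countable _) fun i _ ↦ hSm i _
  have hU : ∀ u, ⋃ i, S i (Function.update ω j u i) = S j u ∪ R := by
    intro u
    ext y
    simp only [hR, mem_iUnion, mem_union, mem_ofPred_eq, exists_prop]
    constructor
    · rintro ⟨i, hi⟩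
      rcases eq_or_ne i j with rfl | h
      · exact Or.inl (by simpa using hi)
      · exact Or.inr ⟨i, h, by simpa [h] using hi⟩
    · rintro (h | ⟨i, h, hi⟩)
      · exact ⟨j, by simpa using h⟩
      · exact ⟨i, by simpa [h] using hi⟩
  have hAu : ∀ u, μ.real (A ∩ (S j u ∪ R)) = u * μ.real (D j) + μ.real (A ∩ R) := by
    intro u
    rw [inter_union_distrib_left, inter_eq_right.2 ((hSD j u).trans (hAB.trans sdiff_subset)),
      measureReal_union ?_ (hA.inter hRm) ?_ (measure_inter_ne_top_of_left_ne_top hAμ), hSμ]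
    · refine Disjoint.mono_right inter_subset_right ?_
      rw [hR, Set.disjoint_iUnion₂_right]
      exact fun i hi ↦ (hD (Ne.symm hi)).mono (hSD j u) (hSD i _)
    · exact measure_ne_top_of_subset ((hSD j u).trans (hAB.trans sdiff_subset)) hAμ
  have hBu : ∀ u, B ∩ (S j u ∪ R) = B ∩ R := by
    intro u
    rw [inter_union_distrib_left, union_eq_right]
    exact fun y hy ↦ absurd hy.1 (hAB (hSD j u hy.2)).2
  have hset : (fun u ↦ (u, ω)) ⁻¹' ((fun p : unitInterval × (ℕ → unitInterval) ↦
      Function.update p.2 j p.1) ⁻¹' bad) =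
      {u : unitInterval | |u * μ.real (D j) + (μ.real (A ∩ R) - μ.real (B ∩ R))| ≤ ε} := by
    ext u
    simp only [bad, mem_preimage, mem_ofPred_eq, hU, hAu, hBu, add_sub_assoc]
  rw [hset]
  exact volume_unitInterval_abs_affine_le hj _ _

end RandomSet

/-! ### Covering bounds from box and packing dimension -/

section Covering

variable {X : Type*} [PseudoMetricSpace X]

theorem exists_finset_cover_of_externalCoveringNumber_ne_top {ε : ℝ≥0} {A : Set X}
    (h : externalCoveringNumber ε A ≠ ⊤) :
    ∃ F : Finset X, (F.card : ℕ∞) = externalCoveringNumber ε A ∧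
      A ⊆ ⋃ x ∈ F, closedBall x ε := by
  have : Nonempty {C : Set X // IsCover ε A C} := by
    by_contra! hempty
    refine h (iInf₂_eq_top.2 fun C hC ↦ (hempty.false ⟨C, hC⟩).elim)
  obtain ⟨⟨C, hC⟩, hCe⟩ := ENat.exists_eq_iInf fun C : {C : Set X // IsCover ε A C} ↦ C.1.encard
  have hN : C.encard = externalCoveringNumber ε A := by
    rw [externalCoveringNumber, iInf_subtype']; exact hCe
  have hfin : C.Finite := encard_ne_top_iff.1 (hN ▸ h)
  refine ⟨hfin.toFinset, by rw [← hN, hfin.encard_eq_coe_toFinset_card], fun x hx ↦ ?_⟩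
  obtain ⟨y, hy, hxy⟩ := hC hx
  refine mem_iUnion₂.2 ⟨y, by simpa using hy, ?_⟩
  rw [← Metric.closedEBall_coe]
  exact hxy

/-- A set of upper box dimension less than `s` is covered by at most `ε ^ (-s)` balls of
radius `ε` for all small `ε`. -/
theorem exists_covering_bound_of_upperBoxDim_lt {A : Set X} {s : ℝ}
    (h : upperBoxDim A < ENNReal.ofReal s) :
    ∃ m : ℕ, ∀ ε : ℝ, 0 < ε → ε ≤ 1 / (m + 1) →
      ∃ F : Finset X, (F.card : ℝ) ≤ ε ^ (-s) ∧ A ⊆ ⋃ x ∈ F, closedBall x ε := by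
  obtain ⟨t, ht⟩ := iInf_lt_iff.1 h
  obtain ⟨hlim, ht⟩ := iInf_lt_iff.1 ht
  have hts : (t : ℝ) < s := by
    rw [← ENNReal.ofReal_coe_nnreal] at ht
    exact (ENNReal.ofReal_lt_ofReal_iff'.1 ht).1
  have hev := eventually_lt_of_limsup_lt (hlim.trans_lt zero_lt_one)
  obtain ⟨δ, hδ, hsub⟩ := mem_nhdsGT_iff_exists_Ioo_subset.1 hev
  -- A threshold of the form `1 / (m + 1)` leaves only countably many cases when sets are later
  -- sorted by it.
  obtain ⟨m, hm⟩ := exists_nat_one_div_lt (show (0 : ℝ) < δ from hδ)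
  refine ⟨m, fun ε hε hεm ↦ ?_⟩
  lift ε to ℝ≥0 using hε.le
  have hε1 : (ε : ℝ) ≤ 1 :=
    hεm.trans ((div_le_one (by positivity)).2 (by linarith [Nat.cast_nonneg (α := ℝ) m]))
  have hlt : (externalCoveringNumber ε A : ℝ≥0∞) * (ε : ℝ≥0∞) ^ (t : ℝ) < 1 :=
    hsub ⟨by exact_mod_cast hε, by exact_mod_cast hεm.trans_lt hm⟩
  have hpow : (ε : ℝ≥0∞) ^ (t : ℝ) ≠ 0 :=
    (ENNReal.rpow_pos (by exact_mod_cast hε) ENNReal.coe_ne_top).ne'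
  have htop : externalCoveringNumber ε A ≠ ⊤ := by
    intro htop
    simp [htop, ENNReal.top_mul hpow] at hlt
  obtain ⟨F, hF, hA⟩ := exists_finset_cover_of_externalCoveringNumber_ne_top htop
  refine ⟨F, ?_, hA⟩
  have hlt' : (F.card : ℝ) * (ε : ℝ) ^ (t : ℝ) < 1 := by
    rw [← hF, ← ENNReal.coe_rpow_of_nonneg _ t.coe_nonneg, ENat.toENNReal_coe,
      ← ENNReal.coe_natCast, ← ENNReal.coe_mul, ENNReal.coe_lt_one_iff] at hlt
    exact_mod_cast hlt
  calc (F.card : ℝ) ≤ (ε : ℝ) ^ (-(t : ℝ)) := by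
        rw [Real.rpow_neg hε.le, ← one_div, le_div_iff₀ (Real.rpow_pos_of_pos hε _)]
        exact hlt'.le
    _ ≤ (ε : ℝ) ^ (-s) := Real.rpow_le_rpow_of_exponent_ge hε hε1 (by linarith)

theorem exists_cover_of_packingDim_lt {A : Set X} {s : ℝ≥0∞} (h : packingDim A < s) :
    ∃ S : ℕ → Set X, A ⊆ ⋃ i, S i ∧ ∀ i, upperBoxDim (S i) < s := by
  obtain ⟨S, hS⟩ := iInf_lt_iff.1 h
  obtain ⟨⟨-, hA⟩, hS⟩ := iInf_lt_iff.1 hS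
  exact ⟨S, hA, fun i ↦ (le_iSup (fun i ↦ upperBoxDim (S i)) i).trans_lt hS⟩

end Covering

/-! ### Symmetric differences and neighbourhoods of frontiers -/

section Neighbourhoods

variable {E : Type*} [NormedAddCommGroup E] [NormedSpace ℝ E]

/-- The part of a compact set outside a Hausdorff-close compact set `A` is close to the frontier
of `A`. -/
theorem sdiff_subset_cthickening_frontier {A A' : NonemptyCompacts E} {ε : ℝ}
    (h : dist A A' ≤ ε) : (A' : Set E) \ A ⊆ cthickening ε (frontier (A : Set E)) := by
  rintro x ⟨hx, hxA⟩
  have hA : (A : Set E).Nonempty := A.nonempty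
  have hd : infDist x (A : Set E) ≤ ε := by
    rw [NonemptyCompacts.dist_eq, hausdorffDist_comm] at h
    exact (infDist_le_hausdorffDist_of_mem hx (hausdorffEDist_ne_top_of_nonempty_of_bounded
      A'.nonempty hA A'.isCompact.isBounded A.isCompact.isBounded)).trans h
  obtain ⟨y, hy, hxy⟩ := A.isCompact.exists_infDist_eq_dist hA x
  -- By connectedness, the segment from `x ∉ A` to its nearest point in `A` meets the frontier.
  obtain ⟨z, hz, hzf⟩ : (segment ℝ x y ∩ frontier (A : Set E)).Nonempty := by
    by_contra! hempty
    have hsub : segment ℝ x y ⊆ (A : Set E)ᶜ ∪ interior A := fun z hz ↦ by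
      by_cases hzA : z ∈ (A : Set E)
      · by_contra hzi
        rw [mem_union, not_or] at hzi
        exact (hempty ▸ ⟨hz, subset_closure hzA, hzi.2⟩ : z ∈ (∅ : Set E))
      · exact Or.inl hzA
    have := (convex_segment x y).isPreconnected.subset_left_of_subset_union
      A.isCompact.isClosed.isOpen_compl isOpen_interior
      (disjoint_compl_left.mono_right interior_subset) hsub ⟨x, left_mem_segment ℝ x y, hxA⟩
    exact this (right_mem_segment ℝ x y) hy
  refine mem_cthickening_of_dist_le x z ε _ hzf ?_
  have := dist_add_dist_of_mem_segment hz
  linarith [dist_nonneg (x := z) (y := y)]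

variable [FiniteDimensional ℝ E] [MeasurableSpace E] [BorelSpace E] (μ : Measure E)
  [μ.IsAddHaarMeasure]

/-- A set covered by at most `ε ^ (-s)` balls of radius `ε` has a small `ε`-neighbourhood. -/
theorem measure_cthickening_le_of_cover {A : Set E} {ε s : ℝ} (hε : 0 < ε) {F : Finset E}
    (hF : (F.card : ℝ) ≤ ε ^ (-s)) (hA : A ⊆ ⋃ x ∈ F, closedBall x ε) :
    μ (cthickening ε A) ≤ ENNReal.ofReal
      (3 ^ Module.finrank ℝ E * μ.real (ball 0 1) * ε ^ (Module.finrank ℝ E - s)) := by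
  have hsub : cthickening ε A ⊆ ⋃ x ∈ F, closedBall x (3 * ε) := by
    intro y hy
    obtain ⟨a, ha, hya⟩ := mem_thickening_iff.1
      (cthickening_subset_thickening' (by positivity : 0 < 2 * ε) (by linarith) A hy)
    obtain ⟨x, hx, hax⟩ := mem_iUnion₂.1 (hA ha)
    refine mem_iUnion₂.2 ⟨x, hx, ?_⟩
    rw [mem_closedBall] at hax ⊢
    linarith [dist_triangle y a x]
  have hω : 0 ≤ μ.real (ball (0 : E) 1) := measureReal_nonneg
  calc μ (cthickening ε A) ≤ ∑ x ∈ F, μ (closedBall x (3 * ε)) :=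
        (measure_mono hsub).trans (measure_biUnion_finset_le _ _)
    _ = ENNReal.ofReal (F.card * ((3 * ε) ^ Module.finrank ℝ E * μ.real (ball 0 1))) := by
        have : ∀ x ∈ F, μ (closedBall x (3 * ε)) =
            ENNReal.ofReal ((3 * ε) ^ Module.finrank ℝ E * μ.real (ball 0 1)) := by
          intro x _
          rw [Measure.addHaar_closedBall μ x (by positivity), ENNReal.ofReal_mul (by positivity),
            ofReal_measureReal measure_ball_lt_top.ne]
        rw [Finset.sum_congr rfl this, Finset.sum_const, nsmul_eq_mul,
          ENNReal.ofReal_mul (Nat.cast_nonneg _), ENNReal.ofReal_natCast]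
    _ ≤ _ := by
        refine ENNReal.ofReal_le_ofReal ?_
        calc F.card * ((3 * ε) ^ Module.finrank ℝ E * μ.real (ball 0 1))
            ≤ ε ^ (-s) * ((3 * ε) ^ Module.finrank ℝ E * μ.real (ball 0 1)) := by gcongr
          _ = _ := by
            rw [sub_eq_add_neg, Real.rpow_add hε, Real.rpow_natCast, mul_pow]; ring

end Neighbourhoods

open scoped symmDiff

/-! ### Union bound over pairs of Hausdorff balls -/

section Reconstruction

variable {E : Type*} [NormedAddCommGroup E] [NormedSpace ℝ E]
  [MeasurableSpace E] [BorelSpace E] (μ : Measure E) [μ.IsAddHaarMeasure]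

/-- Each half of the symmetric difference lies in the neighbourhood of one frontier, whatever `T`
is, so the bound is uniform over test sets. -/
theorem abs_measureReal_inter_sub_le_of_dist_le {A A' : NonemptyCompacts E} {ε V : ℝ}
    (hV : 0 ≤ V) (h : dist A A' ≤ ε)
    (hA : μ (cthickening ε (frontier (A : Set E))) ≤ ENNReal.ofReal V)
    (hA' : μ (cthickening ε (frontier (A' : Set E))) ≤ ENNReal.ofReal V)
    {T : Set E} (hT : MeasurableSet T) :
    |μ.real (A ∩ T) - μ.real (A' ∩ T)| ≤ 2 * V := by
  have hfin : ∀ K : NonemptyCompacts E, μ (K ∩ T) ≠ ⊤ := fun K ↦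
    measure_inter_ne_top_of_left_ne_top K.isCompact.measure_lt_top.ne
  have hm : ∀ K : NonemptyCompacts E, MeasurableSet ((K : Set E) ∩ T) := fun K ↦
    K.isCompact.isClosed.measurableSet.inter hT
  refine (abs_measureReal_sub_le_measureReal_symmDiff' (hm A).nullMeasurableSet
    (hm A').nullMeasurableSet (hfin A) (hfin A')).trans ?_
  refine ENNReal.toReal_le_of_le_ofReal (by positivity) ?_
  have hsub : ((A : Set E) ∩ T) ∆ ((A' : Set E) ∩ T) ⊆
      cthickening ε (frontier (A' : Set E)) ∪ cthickening ε (frontier (A : Set E)) := by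
    rintro x (⟨⟨hx, hxT⟩, hx'⟩ | ⟨⟨hx, hxT⟩, hx'⟩)
    · exact Or.inl (sdiff_subset_cthickening_frontier (dist_comm A A' ▸ h)
        ⟨hx, fun h ↦ hx' ⟨h, hxT⟩⟩)
    · exact Or.inr (sdiff_subset_cthickening_frontier h ⟨hx, fun h ↦ hx' ⟨h, hxT⟩⟩)
  calc μ (((A : Set E) ∩ T) ∆ ((A' : Set E) ∩ T)) ≤ _ := measure_mono hsub
    _ ≤ ENNReal.ofReal V + ENNReal.ofReal V :=
        (measure_union_le _ _).trans (add_le_add hA' hA)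
    _ = ENNReal.ofReal (2 * V) := by rw [← ENNReal.ofReal_add hV hV, two_mul]

variable {Ω : Type*} [MeasurableSpace Ω] (ℙ : Measure Ω) [IsProbabilityMeasure ℙ] {T : Ω → Set E}
  (R : NonemptyCompacts E → NonemptyCompacts E → Prop)

/-- A bound for the probability that `n` independent copies of a random set satisfying a small ball
estimate fail to distinguish some pair of sets close to the pair `(x, y)`. -/
theorem pi_exists_measure_inter_eq_le (hT : ∀ ω, MeasurableSet (T ω)) (n : ℕ)
    {P Q : Set (NonemptyCompacts E)} {ε V c : ℝ} (hV : 0 ≤ V)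
    (hP : ∀ A ∈ P, μ (cthickening (2 * ε) (frontier (A : Set E))) ≤ ENNReal.ofReal V)
    (hQ : ∀ A ∈ Q, μ (cthickening (2 * ε) (frontier (A : Set E))) ≤ ENNReal.ofReal V)
    (hR : ∀ A ∈ P, ∀ B ∈ Q, R A B → ∀ η : ℝ,
      ℙ {ω | |μ.real (A ∩ T ω) - μ.real (B ∩ T ω)| ≤ η} ≤ ENNReal.ofReal (c * η))
    (x y : NonemptyCompacts E) :
    Measure.pi (fun _ : Fin n ↦ ℙ) {ω | ∃ A ∈ P ∩ closedBall x ε, ∃ B ∈ Q ∩ closedBall y ε,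
      R A B ∧ ∀ i, μ (A ∩ T (ω i)) = μ (B ∩ T (ω i))} ≤ ENNReal.ofReal (c * (4 * V)) ^ n := by
  -- The centres `x`, `y` need not lie in the families, so an admissible pair in the balls serves as
  -- reference. Other members are within `2 * ε` of it; two errors of `2 * V` give `4 * V`.
  by_cases hex : ∃ A ∈ P ∩ closedBall x ε, ∃ B ∈ Q ∩ closedBall y ε, R A B
  · obtain ⟨A₀, hA₀, B₀, hB₀, hR₀⟩ := hex
    calc _ ≤ Measure.pi (fun _ : Fin n ↦ ℙ) (Set.pi univ fun _ ↦
            {ω | |μ.real (A₀ ∩ T ω) - μ.real (B₀ ∩ T ω)| ≤ 4 * V}) := measure_mono ?_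
      _ = ∏ _ : Fin n, ℙ {ω | |μ.real (A₀ ∩ T ω) - μ.real (B₀ ∩ T ω)| ≤ 4 * V} :=
          Measure.pi_pi _ _
      _ ≤ ∏ _ : Fin n, ENNReal.ofReal (c * (4 * V)) :=
          Finset.prod_le_prod' fun _ _ ↦ hR A₀ hA₀.1 B₀ hB₀.1 hR₀ _
      _ = _ := by simp
    rintro ω ⟨A, hA, B, hB, -, heq⟩ i -
    have hAA : dist A A₀ ≤ 2 * ε := by
      linarith [dist_triangle_right A A₀ x, mem_closedBall.1 hA.2, mem_closedBall.1 hA₀.2]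
    have hBB : dist B B₀ ≤ 2 * ε := by
      linarith [dist_triangle_right B B₀ y, mem_closedBall.1 hB.2, mem_closedBall.1 hB₀.2]
    have h1 := abs_le.1 (abs_measureReal_inter_sub_le_of_dist_le μ hV hAA (hP A hA.1)
      (hP A₀ hA₀.1) (hT (ω i)))
    have h2 := abs_le.1 (abs_measureReal_inter_sub_le_of_dist_le μ hV hBB (hQ B hB.1)
      (hQ B₀ hB₀.1) (hT (ω i)))
    have h3 : μ.real (A ∩ T (ω i)) = μ.real (B ∩ T (ω i)) := congrArg ENNReal.toReal (heq i)
    show |μ.real (A₀ ∩ T (ω i)) - μ.real (B₀ ∩ T (ω i))| ≤ 4 * V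
    exact abs_le.2 ⟨by linarith [h1.2, h2.1], by linarith [h1.1, h2.2]⟩
  · refine (measure_mono_null (t := ∅) ?_ measure_empty).le.trans zero_le
    rintro ω ⟨A, hA, B, hB, h, -⟩
    exact hex ⟨A, hA, B, hB, h⟩

/-- Almost surely, `n` independent copies of a random set satisfying a small ball estimate
distinguish all pairs of sets from two families with power-like covering numbers, provided that
`n` is large enough. -/
theorem pi_exists_measure_inter_eq_zero (hT : ∀ ω, MeasurableSet (T ω)) {n : ℕ}
    {P Q : Set (NonemptyCompacts E)} {ε₀ s δ v c : ℝ} (hε₀ : 0 < ε₀) (hv : 0 ≤ v) (hc : 0 ≤ c)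
    (hn : 2 * s < n * δ)
    (hPc : ∀ ε : ℝ, 0 < ε → ε ≤ ε₀ → ∃ F : Finset (NonemptyCompacts E),
      (F.card : ℝ) ≤ ε ^ (-s) ∧ P ⊆ ⋃ x ∈ F, closedBall x ε)
    (hQc : ∀ ε : ℝ, 0 < ε → ε ≤ ε₀ → ∃ F : Finset (NonemptyCompacts E),
      (F.card : ℝ) ≤ ε ^ (-s) ∧ Q ⊆ ⋃ x ∈ F, closedBall x ε)
    (hP : ∀ A ∈ P, ∀ ε : ℝ, 0 < ε → ε ≤ ε₀ →
      μ (cthickening ε (frontier (A : Set E))) ≤ ENNReal.ofReal (v * ε ^ δ))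
    (hQ : ∀ A ∈ Q, ∀ ε : ℝ, 0 < ε → ε ≤ ε₀ →
      μ (cthickening ε (frontier (A : Set E))) ≤ ENNReal.ofReal (v * ε ^ δ))
    (hR : ∀ A ∈ P, ∀ B ∈ Q, R A B → ∀ η : ℝ,
      ℙ {ω | |μ.real (A ∩ T ω) - μ.real (B ∩ T ω)| ≤ η} ≤ ENNReal.ofReal (c * η)) :
    Measure.pi (fun _ : Fin n ↦ ℙ) {ω | ∃ A ∈ P, ∃ B ∈ Q,
      R A B ∧ ∀ i, μ (A ∩ T (ω i)) = μ (B ∩ T (ω i))} = 0 := by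
  set bad := {ω : Fin n → Ω | ∃ A ∈ P, ∃ B ∈ Q, R A B ∧ ∀ i, μ (A ∩ T (ω i)) = μ (B ∩ T (ω i))}
  set k : ℝ := (c * (4 * (v * 2 ^ δ))) ^ n
  -- Halving `ε₀` allows the frontier bounds to be used at scale `2 * ε`.
  have hbound : ∀ ε : ℝ, 0 < ε → ε ≤ ε₀ / 2 →
      Measure.pi (fun _ : Fin n ↦ ℙ) bad ≤ ENNReal.ofReal (k * ε ^ (n * δ - 2 * s)) := by
    intro ε hε hε'
    obtain ⟨F, hF, hPF⟩ := hPc ε hε (by linarith)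
    obtain ⟨G, hG, hQG⟩ := hQc ε hε (by linarith)
    set V := v * (2 * ε) ^ δ with hV
    have hV0 : 0 ≤ V := by positivity
    have hsub : bad ⊆ ⋃ x ∈ F, ⋃ y ∈ G, {ω | ∃ A ∈ P ∩ closedBall x ε, ∃ B ∈ Q ∩ closedBall y ε,
        R A B ∧ ∀ i, μ (A ∩ T (ω i)) = μ (B ∩ T (ω i))} := by
      rintro ω ⟨A, hA, B, hB, h⟩
      obtain ⟨x, hx, hAx⟩ := mem_iUnion₂.1 (hPF hA)
      obtain ⟨y, hy, hBy⟩ := mem_iUnion₂.1 (hQG hB)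
      exact mem_iUnion₂.2 ⟨x, hx, mem_iUnion₂.2 ⟨y, hy, A, ⟨hA, hAx⟩, B, ⟨hB, hBy⟩, h⟩⟩
    calc Measure.pi (fun _ : Fin n ↦ ℙ) bad
        ≤ ∑ x ∈ F, ∑ y ∈ G, ENNReal.ofReal (c * (4 * V)) ^ n := by
          refine (measure_mono hsub).trans ((measure_biUnion_finset_le _ _).trans ?_)
          refine Finset.sum_le_sum fun x _ ↦ (measure_biUnion_finset_le _ _).trans ?_
          exact Finset.sum_le_sum fun y _ ↦ pi_exists_measure_inter_eq_le μ ℙ R hT n hV0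
            (fun A hA ↦ hP A hA _ (by positivity) (by linarith))
            (fun A hA ↦ hQ A hA _ (by positivity) (by linarith)) hR x y
      _ = ENNReal.ofReal (F.card * (G.card * (c * (4 * V)) ^ n)) := by
          simp only [Finset.sum_const, nsmul_eq_mul]
          rw [ENNReal.ofReal_mul (Nat.cast_nonneg _), ENNReal.ofReal_mul (Nat.cast_nonneg _),
            ENNReal.ofReal_pow (by positivity), ENNReal.ofReal_natCast, ENNReal.ofReal_natCast]
      _ ≤ ENNReal.ofReal (k * ε ^ (n * δ - 2 * s)) := by
          refine ENNReal.ofReal_le_ofReal ?_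
          calc F.card * (G.card * (c * (4 * V)) ^ n)
              ≤ ε ^ (-s) * (ε ^ (-s) * (c * (4 * V)) ^ n) := by gcongr
            _ = k * ε ^ (n * δ - 2 * s) := by
              have h1 : ε ^ (n * δ - 2 * s) = ε ^ (-s) * ε ^ (-s) * (ε ^ δ) ^ n := by
                rw [← Real.rpow_mul_natCast hε.le, ← Real.rpow_add hε, ← Real.rpow_add hε]
                congr 1; ring
              rw [h1, hV, Real.mul_rpow two_pos.le hε.le]
              simp only [k, mul_pow]; ring
  have hlim : Tendsto (fun ε : ℝ ↦ ENNReal.ofReal (k * ε ^ (n * δ - 2 * s))) (𝓝[>] 0) (𝓝 0) := by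
    have h1 : Tendsto (fun ε : ℝ ↦ k * ε ^ (n * δ - 2 * s)) (𝓝[>] 0) (𝓝 0) := by
      have := (Real.continuousAt_rpow_const 0 (n * δ - 2 * s) (Or.inr (by linarith))).tendsto
      rw [Real.zero_rpow (by linarith)] at this
      simpa using (this.mono_left nhdsWithin_le_nhds).const_mul k
    simpa using ENNReal.tendsto_ofReal h1
  refine le_antisymm (ge_of_tendsto hlim ?_) zero_le
  filter_upwards [Ioc_mem_nhdsGT (half_pos hε₀)] with ε hε
  exact hbound ε hε.1 hε.2

end Reconstruction

/-! ### Countable decomposition and conclusion -/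

/-- A compact set which is the closure of its interior and is not contained in the closed set `B`
exceeds `B` by a set with nonempty interior. -/
theorem interior_sdiff_nonempty_of_not_subset {X : Type*} [TopologicalSpace X] {A B : Set X}
    (hA : A = closure (interior A)) (hB : IsClosed B) (h : ¬A ⊆ B) :
    (interior A \ B).Nonempty := by
  by_contra! hempty
  rw [sdiff_eq_empty] at hempty
  exact h (hA ▸ hB.closure_subset_iff.2 hempty)

theorem exists_measurableSet_family_of_packingDim_lt {E : Type*} [NormedAddCommGroup E]
    [NormedSpace ℝ E] [FiniteDimensional ℝ E] [Nontrivial E] [MeasurableSpace E] [BorelSpace E]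
    (μ : Measure E) [μ.IsAddHaarMeasure] {C : Set (NonemptyCompacts E)}
    (hC : ∀ K ∈ C, (K : Set E) = closure (interior (K : Set E))) {n : ℕ} {s b : ℝ}
    (hs : packingDim C < ENNReal.ofReal s)
    (hb : ∀ K ∈ C, upperBoxDim (frontier (K : Set E)) < ENNReal.ofReal b)
    (hn : 2 * s < n * (Module.finrank ℝ E - b)) :
    ∃ T : Fin n → Set E, (∀ i, MeasurableSet (T i)) ∧
      ∀ A ∈ C, ∀ B ∈ C, (∀ i, μ (A ∩ T i) = μ (B ∩ T i)) → A = B := by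
  obtain ⟨D, hD, hDm, hDb, hDpos, hDU⟩ := exists_disjoint_seq_subset_of_isOpen μ
  choose S hS hSm hSD hSμ using
    fun j ↦ exists_monotone_subsets_measureReal_eq μ (hDm j) (hDb j)
  set ℙ : Measure (ℕ → unitInterval) := Measure.infinitePi fun _ ↦ volume
  set T : (ℕ → unitInterval) → Set E := fun ω ↦ ⋃ j, S j (ω j)
  have hT : ∀ ω, MeasurableSet (T ω) := fun ω ↦ MeasurableSet.iUnion fun j ↦ hSm j _
  obtain ⟨X, hCX, hX⟩ := exists_cover_of_packingDim_lt hs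
  choose m hm using fun i ↦ exists_covering_bound_of_upperBoxDim_lt (hX i)
  -- The second index makes the scale from which the frontier bound holds uniform within each piece.
  set P : ℕ × ℕ → Set (NonemptyCompacts E) := fun p ↦ X p.1 ∩
    {K | ∀ ε : ℝ, 0 < ε → ε ≤ 1 / (p.2 + 1) → ∃ F : Finset E,
      (F.card : ℝ) ≤ ε ^ (-b) ∧ frontier (K : Set E) ⊆ ⋃ x ∈ F, closedBall x ε} with hPdef
  have hCP : ∀ K ∈ C, ∃ p, K ∈ P p := by
    intro K hK
    obtain ⟨i, hi⟩ := mem_iUnion.1 (hCX hK)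
    obtain ⟨l, hl⟩ := exists_covering_bound_of_upperBoxDim_lt (hb K hK)
    exact ⟨(i, l), hi, hl⟩
  have hnull : ∀ (j : ℕ) (p q : ℕ × ℕ), Measure.pi (fun _ : Fin n ↦ ℙ) {ω | ∃ A ∈ P p, ∃ B ∈ P q,
      D j ⊆ (A : Set E) \ B ∧ ∀ i, μ (A ∩ T (ω i)) = μ (B ∩ T (ω i))} = 0 := by
    intro j p q
    set ε₀ : ℝ := min (min (1 / (m p.1 + 1)) (1 / (m q.1 + 1)))
      (min (1 / (p.2 + 1)) (1 / (q.2 + 1))) with hε₀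
    have hε₀pos : 0 < ε₀ := by positivity
    refine pi_exists_measure_inter_eq_zero μ ℙ (fun A B ↦ D j ⊆ (A : Set E) \ B) hT
      (v := 3 ^ Module.finrank ℝ E * μ.real (ball 0 1)) (c := 2 / μ.real (D j))
      hε₀pos (by positivity) (by positivity) hn ?_ ?_ ?_ ?_ ?_
    · intro ε h0 h
      simp only [hε₀, le_min_iff] at h
      obtain ⟨F, hF, hXF⟩ := hm p.1 ε h0 h.1.1
      exact ⟨F, hF, inter_subset_left.trans hXF⟩
    · intro ε h0 h
      simp only [hε₀, le_min_iff] at h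
      obtain ⟨F, hF, hXF⟩ := hm q.1 ε h0 h.1.2
      exact ⟨F, hF, inter_subset_left.trans hXF⟩
    · intro A hA ε h0 h
      simp only [hε₀, le_min_iff] at h
      obtain ⟨F, hF, hAF⟩ := hA.2 ε h0 h.2.1
      exact measure_cthickening_le_of_cover μ h0 hF hAF
    · intro A hA ε h0 h
      simp only [hε₀, le_min_iff] at h
      obtain ⟨F, hF, hAF⟩ := hA.2 ε h0 h.2.2
      exact measure_cthickening_le_of_cover μ h0 hF hAF
    · intro A _ B _ hAB η
      exact infinitePi_abs_measureReal_sub_le hD hS hSm hSD (hDpos j) (hSμ j)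
        A.isCompact.isClosed.measurableSet B.isCompact.isClosed.measurableSet
        A.isCompact.measure_lt_top.ne hAB η
  have hae : ∀ᵐ ω ∂Measure.pi (fun _ : Fin n ↦ ℙ), ∀ (j : ℕ) (p q : ℕ × ℕ),
      ¬∃ A ∈ P p, ∃ B ∈ P q, D j ⊆ (A : Set E) \ B ∧ ∀ i, μ (A ∩ T (ω i)) = μ (B ∩ T (ω i)) := by
    simp only [ae_all_iff]
    intro j p q
    rw [ae_iff]
    simpa only [not_not] using hnull j p q
  obtain ⟨ω, hω⟩ := hae.exists
  have hsub : ∀ A ∈ C, ∀ B ∈ C, (∀ i, μ (A ∩ T (ω i)) = μ (B ∩ T (ω i))) → (A : Set E) ⊆ B := by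
    intro A hA B hB heq
    by_contra hAB
    obtain ⟨j, hj⟩ := hDU _ (isOpen_interior.sdiff B.isCompact.isClosed)
      (interior_sdiff_nonempty_of_not_subset (hC A hA) B.isCompact.isClosed hAB)
    obtain ⟨p, hp⟩ := hCP A hA
    obtain ⟨q, hq⟩ := hCP B hB
    exact hω j p q ⟨A, hp, B, hq, hj.trans (sdiff_subset_sdiff_left interior_subset), heq⟩
  exact ⟨fun i ↦ T (ω i), fun i ↦ hT _, fun A hA B hB heq ↦ SetLike.coe_injective
    ((hsub A hA B hB heq).antisymm (hsub B hB A hA fun i ↦ (heq i).symm))⟩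

/-- Common form of both parts: the strict inequality for `n` leaves room to enlarge both dimensions
slightly. -/
theorem canBeReconstructed_of_upperBoxDim_frontier_le {d : ℕ}
    {C : Set (NonemptyCompacts (EuclideanSpace ℝ (Fin d)))}
    (hC : ∀ K ∈ C, (K : Set (EuclideanSpace ℝ (Fin d))) =
      closure (interior (K : Set (EuclideanSpace ℝ (Fin d)))))
    {b : ℝ} (hb : b < d) (htop : packingDim C < ⊤)
    (hfr : ∀ K ∈ C, (upperBoxDim (frontier (K : Set (EuclideanSpace ℝ (Fin d)))) : EReal) ≤ b)
    {n : ℕ} (hn : 2 * (packingDim C).toReal < n * (d - b)) :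
    CanBeReconstructed (underlyingSets C) n := by
  rcases C.eq_empty_or_nonempty with rfl | ⟨K₀, hK₀⟩
  · exact ⟨fun _ ↦ ∅, fun _ ↦ MeasurableSet.empty.nullMeasurableSet,
      fun A hA ↦ by simp [underlyingSets] at hA⟩
  -- A member of `C` forces `b ≥ 0`, hence `d > 0`, so the space is nontrivial.
  have hb0 : 0 ≤ b := by
    have := (EReal.coe_ennreal_nonneg _).trans (hfr K₀ hK₀)
    exact_mod_cast this
  have hd : 0 < d := by exact_mod_cast hb0.trans_lt hb
  have : Nonempty (Fin d) := ⟨⟨0, hd⟩⟩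
  set p := (packingDim C).toReal
  have hp : 0 ≤ p := ENNReal.toReal_nonneg
  -- This is `2 * (p + η) < n * (d - (b + η))` rearranged.
  obtain ⟨η, hη0, hη⟩ : ∃ η : ℝ, 0 < η ∧ η * (n + 2) < n * (d - b) - 2 * p :=
    ⟨(n * (d - b) - 2 * p) / 2 / (n + 2), by have : 0 < n * (d - b) - 2 * p := by linarith
                                             positivity, by
      rw [div_mul_cancel₀ _ (by positivity)]; linarith⟩
  have hs : packingDim C < ENNReal.ofReal (p + η) := by
    rw [ENNReal.lt_ofReal_iff_toReal_lt htop.ne]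
    linarith
  have hbη : ∀ K ∈ C, upperBoxDim (frontier (K : Set (EuclideanSpace ℝ (Fin d)))) <
      ENNReal.ofReal (b + η) := by
    intro K hK
    have h1 : upperBoxDim (frontier (K : Set (EuclideanSpace ℝ (Fin d)))) ≤ ENNReal.ofReal b := by
      rw [← EReal.coe_ennreal_le_coe_ennreal_iff, EReal.coe_ennreal_ofReal, max_eq_left hb0]
      exact hfr K hK
    exact h1.trans_lt ((ENNReal.ofReal_lt_ofReal_iff (by linarith)).2 (by linarith))
  obtain ⟨T, hT, hinj⟩ := exists_measurableSet_family_of_packingDim_lt volume hC (n := n) hs hbη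
    (by rw [finrank_euclideanSpace_fin]; linarith)
  refine ⟨T, fun i ↦ (hT i).nullMeasurableSet, ?_⟩
  rintro _ ⟨A, hA, rfl⟩ _ ⟨B, hB, rfl⟩ heq
  rw [hinj A hA B hB heq]

theorem mainTheorem4 (d : ℕ) (C : Set (NonemptyCompacts (EuclideanSpace ℝ (Fin d))))
    (hC : ∀ K ∈ C, (K : Set (EuclideanSpace ℝ (Fin d))) =
      closure (interior (K : Set (EuclideanSpace ℝ (Fin d))))) :
    (∀ k : ℕ, 1 ≤ k → packingDim C ≤ (k : ℝ≥0∞) →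
      (∀ K ∈ C, (upperBoxDim (frontier (K : Set (EuclideanSpace ℝ (Fin d)))) : EReal) =
        (((d : ℝ) - 1 : ℝ) : EReal)) →
      CanBeReconstructed (underlyingSets C) (2 * k + 1)) ∧
    (∀ b : ℝ, b < (d : ℝ) → packingDim C < ⊤ →
      (∀ K ∈ C, (upperBoxDim (frontier (K : Set (EuclideanSpace ℝ (Fin d)))) : EReal) ≤
        (b : EReal)) →
      CanBeReconstructed (underlyingSets C)
        (⌊2 * (packingDim C).toReal / ((d : ℝ) - b)⌋₊ + 1)) := by
  refine ⟨fun k _ hk hfr ↦ ?_, fun b hb htop hfr ↦ ?_⟩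
  · refine canBeReconstructed_of_upperBoxDim_frontier_le hC (b := d - 1) (by linarith)
      (hk.trans_lt (ENNReal.natCast_lt_top k)) (fun K hK ↦ (hfr K hK).le) ?_
    have : (packingDim C).toReal ≤ k := ENNReal.toReal_le_of_le_ofReal (Nat.cast_nonneg _)
      (by rwa [ENNReal.ofReal_natCast])
    push_cast
    linarith
  · refine canBeReconstructed_of_upperBoxDim_frontier_le hC hb htop hfr ?_
    rw [← div_lt_iff₀ (by linarith)]
    exact_mod_cast Nat.lt_floor_add_one _
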